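/- Let $\mathcal X,\mathcal Y$ be finite-dimensional real inner product spaces, let $X\subseteq\mathcal X$ and $Y\subseteq\mathcal Y$ be nonempty convex sets with $Y$ compact, let $\Omega\supseteq X$ be open in $\mathcal X$, and let $\Psi$ be a real function of $(x,y)$ and $h:\mathcal X\to(-\infty,\infty]$ such that: (i) $\Psi$ is continuous on $\Omega\times Y$, and $\nabla_x\Psi(x,y)$ exists at every $(x,y)\in\Omega\times Y$ and is continuous on $\Omega\times Y$; (ii) $h$ is proper, lower semicontinuous and convex with effective domain $\{x: h(x)<\infty\}$ equal to $X$; and for every $x\in\Omega$ the function on $\mathcal Y$ equal to $-\Psi(x,\cdot)$ on $Y$ and to $+\infty$ outside $Y$ is proper, lower semicontinuous and convex; (iii) there are $L_x,L_y>0$ and $m\in(0,L_x]$ such that for all $x,x'\in X$ and $y,y'\in Y$, $$\Psi(x,y)-\left[\Psi(x',y)+\langle\nabla_x\Psi(x',y),x-x'\rangle\right]\ge-\tfrac m2\|x-x'\|^2,\qquad \|\nabla_x\Psi(x,y)-\nabla_x\Psi(x',y')\|\le L_x\|x-x'\|+L_y\|y-y'\|;$$ (iv) $\Psi(\cdot,y)$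 is convex on $X$ for every $y\in Y$. Put $q(x)=\max_{y\in Y}\Psi(x,y)$ and $Y(x)=\{y\in Y:\Psi(x,y)=q(x)\}$ for $x\in\Omega$; the function $q+h$ is $+\infty$ outside $X$. For $\bar x\in X$ let $\partial h(\bar x)=\{w:\ h(z)\ge h(\bar x)+\langle w,z-\bar x\rangle\ \forall z\in\mathcal X\}$ and $$Q(\bar x)=\partial h(\bar x)+\bigcup_{y\in Y(\bar x)}\{\nabla_x\Psi(\bar x,y)\}.$$ Then for every $\bar x\in X$ the directional derivative $(q+h)'(\bar x;d)=\lim_{t\downarrow0}\frac{(q+h)(\bar x+td)-(q+h)(\bar x)}{t}$ exists in $[-\infty,\infty]$ for every $d\in\mathcal X$, and $$\inf_{\|d\|\le1}(q+h)'(\bar x;d)=-\inf_{u\in Q(\bar x)}\|u\|,$$ where the infimum over the empty set is $+\infty$ (so both sides are $-\infty$ when $\partial h(\bar x)=\emptyset$). Moreover, if $\partial h(\bar x)\ne\emptyset$, then the infimum on the right-hand side is attained. -/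

import Mathlib

open Filter Set
open scoped Topology Pointwise

noncomputable section

namespace MinMax

variable {E : Type*} [NormedAddCommGroup E] [InnerProductSpace ℝ E]
variable {F : Type*} [NormedAddCommGroup F] [InnerProductSpace ℝ F]

/-- The effective domain of an extended-real-valued function. -/
def effDom (f : E → EReal) : Set E := {x | f x < ⊤}

/-- Proper, lower semicontinuous, convex functions `f : E → (-∞, ∞]` whose effective domain is
exactly `Z` (the class usually written as "Conv-bar of `Z`"). -/
structure IsClosedConvexOn (Z : Set E) (f : E → EReal) : Prop where
  ne_bot : ∀ x, f x ≠ ⊥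
  proper : (effDom f).Nonempty
  dom_eq : effDom f = Z
  convex : ∀ x y : E, ∀ a b : ℝ, 0 < a → 0 < b → a + b = 1 →
    f (a • x + b • y) ≤ (a : EReal) * f x + (b : EReal) * f y
  lsc : LowerSemicontinuous f

open Classical in
/-- The extension by `+∞` of a real function given on `Z`. -/
def extendTop (Z : Set E) (g : E → ℝ) : E → EReal := fun z => if z ∈ Z then (g z : EReal) else ⊤

/-- The (convex-analysis) subdifferential of `f` at `x`. -/
def subdifferential (f : E → EReal) (x : E) : Set E :=
  {w | ∀ z, f x + ((inner ℝ w (z - x) : ℝ) : EReal) ≤ f z}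

/-- `f` has (one-sided, extended-real) directional derivative `l` at `x` in the direction `d`:
`(f (x + t d) - f x) / t → l` as `t ↓ 0`. -/
def HasDirDeriv (f : E → EReal) (x d : E) (l : EReal) : Prop :=
  Tendsto (fun t : ℝ => (f (x + t • d) - f x) / (t : EReal)) (𝓝[>] 0) (𝓝 l)

/-- The directional derivative `f'(x; d)`, as a limit in the extended reals. -/
def dirDeriv (f : E → EReal) (x d : E) : EReal :=
  limUnder (𝓝[>] (0 : ℝ)) (fun t : ℝ => (f (x + t • d) - f x) / (t : EReal))

/-- The partial gradient `∇ₓ Ψ(x, y)`. -/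
def gradX [CompleteSpace E] (Ψ : E → F → ℝ) (x : E) (y : F) : E :=
  gradient (fun x' => Ψ x' y) x

/-- The max function `q(x) = sup_{y ∈ Y} Ψ(x, y)`; under the assumptions below the supremum is a
maximum for every `x ∈ Ω`, and other `x` play no role. -/
def maxFun (Ψ : E → F → ℝ) (Y : Set F) (x : E) : ℝ := sSup ((fun y => Ψ x y) '' Y)

/-- The set `Y(x)` of maximizers of `Ψ(x, ·)` over `Y`. -/
def maximizers (Ψ : E → F → ℝ) (Y : Set F) (x : E) : Set F :=
  {y ∈ Y | Ψ x y = maxFun Ψ Y x}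

/-- The composite function `q + h`. -/
def composite (Ψ : E → F → ℝ) (h : E → EReal) (Y : Set F) (x : E) : EReal :=
  (maxFun Ψ Y x : EReal) + h x

/-- The set `Q(x) = ∂h(x) + ⋃_{y ∈ Y(x)} {∇ₓ Ψ(x, y)}` (a Minkowski sum). -/
def stationaritySet [CompleteSpace E] (Ψ : E → F → ℝ) (h : E → EReal) (Y : Set F) (x : E) :
    Set E :=
  subdifferential h x + ⋃ y ∈ maximizers Ψ Y x, {gradX Ψ x y}

/-- The standing assumptions on the data `(Ψ, h, X, Y)` of the min-max problem, with `Ω` the open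
set containing `X` on which `Ψ(·, y)` is smooth. -/
structure StandingAssumptions [CompleteSpace E] (Ψ : E → F → ℝ) (h : E → EReal)
    (X Ω : Set E) (Y : Set F) : Prop where
  X_nonempty : X.Nonempty
  X_convex : Convex ℝ X
  Y_nonempty : Y.Nonempty
  Y_convex : Convex ℝ Y
  Y_compact : IsCompact Y
  Ω_open : IsOpen Ω
  X_subset : X ⊆ Ω
  cont : ContinuousOn (fun p : E × F => Ψ p.1 p.2) (Ω ×ˢ Y)
  diff : ∀ x ∈ Ω, ∀ y ∈ Y, DifferentiableAt ℝ (fun x' => Ψ x' y) x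
  grad_cont : ContinuousOn (fun p : E × F => gradX Ψ p.1 p.2) (Ω ×ˢ Y)
  h_closedConvex : IsClosedConvexOn X h
  neg_closedConvex : ∀ x ∈ Ω, IsClosedConvexOn Y (extendTop Y (fun y => -Ψ x y))
  curvature : ∃ Lx Ly m : ℝ, 0 < Lx ∧ 0 < Ly ∧ 0 < m ∧ m ≤ Lx ∧
    ∀ x ∈ X, ∀ x' ∈ X, ∀ y ∈ Y, ∀ y' ∈ Y,
      -(m / 2) * ‖x - x'‖ ^ 2 ≤ Ψ x y - (Ψ x' y + inner ℝ (gradX Ψ x' y) (x - x')) ∧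
      ‖gradX Ψ x y - gradX Ψ x' y'‖ ≤ Lx * ‖x - x'‖ + Ly * ‖y - y'‖

end MinMax

end

/-! With `G = q + g`, where `g` is `h` on `X`, convexity of `G` makes difference quotients monotone,
so directional derivatives exist as infima of slopes. For `y ∈ Y(x̄)`, the convex function `Ψ(·, y)
+ g` minorizes `G` and touches it at `x̄`. Hence elements `u` of `Q(x̄)` are subgradients of `G`,
which bounds every derivative along the unit ball below by `-‖u‖`. Conversely, if the infimum of the
derivatives is a finite `-M`, then `G(z) + M‖z - x̄‖ ≥ G(x̄)` on `X`. The left side is the maximum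
of `Ψ(z, y) + g(z) + ⟨b, z - x̄⟩` over `y ∈ Y`, `‖b‖ ≤ M`. Sion's theorem gives one pair `(y, b)`
that works for all `z`; then `y ∈ Y(x̄)` and first-order optimality at `x̄` puts `-b` in `Q(x̄)`.
This is `exists_mem_stationaritySet_norm_le`; it yields both the equality and attainment. -/

namespace MinMax

/-! ### Minimax with one compact side -/

section Minimax

variable {P E : Type*} [AddCommGroup P] [Module ℝ P] [TopologicalSpace P]
  [IsTopologicalAddGroup P] [ContinuousSMul ℝ P]
  [AddCommGroup E] [Module ℝ E] [TopologicalSpace E]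
  [IsTopologicalAddGroup E] [ContinuousSMul ℝ E]

/-- Sion's minimax theorem in the form of exchanging quantifiers, only one of the two sets being
compact. -/
theorem exists_forall_le_of_forall_exists_le {K : Set P} {X : Set E} {g : P → E → ℝ} {c : ℝ}
    (hK : IsCompact K) (hKc : Convex ℝ K) (hKne : K.Nonempty) (hX : Convex ℝ X)
    (hconc : ∀ z ∈ X, ConcaveOn ℝ K (fun k => g k z))
    (husc : ∀ z ∈ X, UpperSemicontinuousOn (fun k => g k z) K)
    (hconv : ∀ k ∈ K, ConvexOn ℝ X (g k))
    (hlsc : ∀ k ∈ K, LowerSemicontinuousOn (g k) X)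
    (H : ∀ z ∈ X, ∃ k ∈ K, c ≤ g k z) :
    ∃ k ∈ K, ∀ z ∈ X, c ≤ g k z := by
  by_contra! hcon
  choose! ζ hζX hζ using hcon
  -- Compactness of `K` leaves finitely many test points `ζ k`, which is what the finite form of
  -- Sion's theorem requires.
  obtain ⟨s, hsK, hs⟩ := hK.elim_nhdsWithin_subcover (fun k => {k' | g k' (ζ k) < c})
    (fun k hk => husc _ (hζX k hk) k hk c (hζ k hk))
  -- The sign change turns maximization over the compact `K` into minimization.
  have key := Sion.exists_lt_iInf_of_lt_iInf_of_finite (X := K) (Y := X)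
    (f := fun k z => -g k z) hKne hK
    (fun z hz k hk => by
      simpa using (husc z hz).neg k hk)
    (fun z hz => (hconc z hz).neg.quasiconvexOn) hX
    (fun k hk z hz => by simpa using (hlsc k hk).neg z hz)
    (fun k hk => (hconv k hk).neg.quasiconcaveOn) hKc
    (s := ζ '' s) (s.finite_toSet.image ζ) (by
      rintro _ ⟨k, hk, rfl⟩
      exact hζX k (hsK k hk)) (t := -c) (by
      intro k hk
      obtain ⟨k', hk', h⟩ := mem_iUnion₂.1 (hs hk)
      exact ⟨ζ k', ⟨k', hk', rfl⟩, neg_lt_neg h⟩)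
  obtain ⟨z, hz, h⟩ := key
  obtain ⟨k, hk, h'⟩ := H z hz
  linarith [h k hk]

end Minimax

/-! ### Slopes and directional derivatives of convex functions -/

theorem extendTop_of_mem {α : Type*} {Z : Set α} {g : α → ℝ} {z : α} (hz : z ∈ Z) :
    extendTop Z g z = (g z : EReal) := if_pos hz

theorem extendTop_of_notMem {α : Type*} {Z : Set α} {g : α → ℝ} {z : α} (hz : z ∉ Z) :
    extendTop Z g z = ⊤ := if_neg hz

variable {E : Type*} [NormedAddCommGroup E] [InnerProductSpace ℝ E]

theorem mem_subdifferential_extendTop_iff {X : Set E} {g : E → ℝ} {x w : E} (hx : x ∈ X) :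
    w ∈ subdifferential (extendTop X g) x ↔ ∀ z ∈ X, g x + inner ℝ w (z - x) ≤ g z := by
  refine ⟨fun hw z hz => ?_, fun hw z => ?_⟩
  · have := hw z
    rw [extendTop_of_mem hx, extendTop_of_mem hz] at this
    exact_mod_cast this
  · by_cases hz : z ∈ X
    · rw [extendTop_of_mem hx, extendTop_of_mem hz]
      exact_mod_cast hw z hz
    · rw [extendTop_of_notMem hz]
      exact le_top

theorem slope_extendTop_of_mem {X : Set E} {g : E → ℝ} {x d : E} {t : ℝ} (hx : x ∈ X)
    (hd : x + t • d ∈ X) :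
    (extendTop X g (x + t • d) - extendTop X g x) / (t : EReal)
      = (((g (x + t • d) - g x) / t : ℝ) : EReal) := by
  rw [extendTop_of_mem hx, extendTop_of_mem hd, EReal.coe_div, EReal.coe_sub]

theorem slope_extendTop_of_notMem {X : Set E} {g : E → ℝ} {x d : E} {t : ℝ} (ht : 0 < t)
    (hx : x ∈ X) (hd : x + t • d ∉ X) :
    (extendTop X g (x + t • d) - extendTop X g x) / (t : EReal) = ⊤ := by
  rw [extendTop_of_mem hx, extendTop_of_notMem hd, EReal.top_sub_coe,
    EReal.top_div_of_pos_ne_top (by exact_mod_cast ht) (EReal.coe_ne_top t)]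

/-- For `s ≤ t`, the point `x + s • d` is the convex combination of `x` and `x + t • d` with weight
`s / t`; once the ray leaves `X`, the slope is `⊤`. -/
theorem monotoneOn_slope_extendTop {X : Set E} {g : E → ℝ} (hg : ConvexOn ℝ X g) {x : E}
    (hx : x ∈ X) (d : E) :
    MonotoneOn (fun t : ℝ => (extendTop X g (x + t • d) - extendTop X g x) / (t : EReal))
      (Ioi 0) := by
  intro s hs t ht hst
  have hs : 0 < s := hs
  have ht : 0 < t := ht
  by_cases htX : x + t • d ∈ X
  · have ha : 0 ≤ 1 - s / t := sub_nonneg.2 ((div_le_one ht).2 hst)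
    have hb : 0 ≤ s / t := by positivity
    have heq : (1 - s / t) • x + (s / t) • (x + t • d) = x + s • d := by
      rw [smul_add, smul_smul, div_mul_cancel₀ _ ht.ne', sub_smul, one_smul]
      abel
    have hsX : x + s • d ∈ X := heq ▸ hg.1 hx htX ha hb (by ring)
    have hle := hg.2 hx htX ha hb (by ring)
    rw [heq, smul_eq_mul, smul_eq_mul] at hle
    simp only [slope_extendTop_of_mem hx htX, slope_extendTop_of_mem hx hsX]
    rw [EReal.coe_le_coe_iff, div_le_div_iff₀ hs ht]
    have h2 : s / t * t = s := div_mul_cancel₀ _ ht.ne'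
    have h3 := mul_le_mul_of_nonneg_right hle ht.le
    have h4 : ((1 - s / t) * g x + s / t * g (x + t • d)) * t
        = t * g x - (s / t * t) * g x + (s / t * t) * g (x + t • d) := by ring
    rw [h4, h2] at h3
    linarith
  · simp only [slope_extendTop_of_notMem ht hx htX]
    exact le_top

theorem tendsto_slope_extendTop {X : Set E} {g : E → ℝ} (hg : ConvexOn ℝ X g) {x : E}
    (hx : x ∈ X) (d : E) :
    HasDirDeriv (extendTop X g) x d
      (⨅ t ∈ Ioi (0 : ℝ), (extendTop X g (x + t • d) - extendTop X g x) / (t : EReal)) := by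
  rw [← sInf_image]
  exact (monotoneOn_slope_extendTop hg hx d).tendsto_nhdsGT (OrderBot.bddBelow _)

theorem dirDeriv_extendTop {X : Set E} {g : E → ℝ} (hg : ConvexOn ℝ X g) {x : E}
    (hx : x ∈ X) (d : E) :
    dirDeriv (extendTop X g) x d
      = ⨅ t ∈ Ioi (0 : ℝ), (extendTop X g (x + t • d) - extendTop X g x) / (t : EReal) :=
  (tendsto_slope_extendTop hg hx d).limUnder_eq

theorem neg_norm_le_dirDeriv_of_mem_subdifferential {X : Set E} {g : E → ℝ}
    (hg : ConvexOn ℝ X g) {x w d : E} (hx : x ∈ X)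
    (hw : w ∈ subdifferential (extendTop X g) x) (hd : ‖d‖ ≤ 1) :
    ((-‖w‖ : ℝ) : EReal) ≤ dirDeriv (extendTop X g) x d := by
  rw [dirDeriv_extendTop hg hx]
  refine le_iInf₂ fun t (ht : 0 < t) => ?_
  by_cases htX : x + t • d ∈ X
  · rw [slope_extendTop_of_mem hx htX, EReal.coe_le_coe_iff, le_div_iff₀ ht]
    have h1 := (mem_subdifferential_extendTop_iff hx).1 hw _ htX
    rw [add_sub_cancel_left, inner_smul_right] at h1
    have h2 : -‖w‖ ≤ inner ℝ w d := by
      have := abs_le.1 (abs_real_inner_le_norm w d)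
      nlinarith [norm_nonneg w]
    nlinarith
  · rw [slope_extendTop_of_notMem ht hx htX]
    exact le_top

/-- A directional derivative is at most every slope; take the unit direction towards `z` and step
`‖z - x‖`. -/
theorem sub_mul_norm_le_of_le_dirDeriv {X : Set E} {g : E → ℝ} (hg : ConvexOn ℝ X g) {x : E}
    (hx : x ∈ X) {M : ℝ}
    (hM : ∀ d ∈ Metric.closedBall (0 : E) 1, ((-M : ℝ) : EReal) ≤ dirDeriv (extendTop X g) x d)
    {z : E} (hz : z ∈ X) : g x - M * ‖z - x‖ ≤ g z := by
  rcases eq_or_ne z x with rfl | hne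
  · simp
  have hpos : 0 < ‖z - x‖ := norm_pos_iff.2 (sub_ne_zero.2 hne)
  have heq : x + ‖z - x‖ • (‖z - x‖⁻¹ • (z - x)) = z := by
    rw [smul_smul, mul_inv_cancel₀ hpos.ne', one_smul, add_sub_cancel]
  have h1 := hM (‖z - x‖⁻¹ • (z - x)) (by
    rw [mem_closedBall_zero_iff, norm_smul, norm_inv, norm_norm, inv_mul_cancel₀ hpos.ne'])
  rw [dirDeriv_extendTop hg hx] at h1
  have h2 := h1.trans (iInf₂_le ‖z - x‖ hpos)
  rw [slope_extendTop_of_mem hx (heq.symm ▸ hz), heq, EReal.coe_le_coe_iff,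
    le_div_iff₀ hpos] at h2
  linarith

/-! ### First-order conditions along segments -/

/-- The derivative of `f` at `x` in the direction `z - x`, along the segment. -/
theorem hasDerivAt_comp_segment [CompleteSpace E] {f : E → ℝ} {x : E}
    (hf : DifferentiableAt ℝ f x) (z : E) :
    HasDerivAt (fun t : ℝ => f (x + t • (z - x))) (inner ℝ (gradient f x) (z - x)) 0 := by
  have h1 : HasDerivAt (fun t : ℝ => x + t • (z - x)) (z - x) 0 := by
    simpa using ((hasDerivAt_id (0 : ℝ)).smul_const (z - x)).const_add x
  have h2 := hf.hasGradientAt.hasFDerivAt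
  have h3 : HasFDerivAt f (InnerProductSpace.toDual ℝ E (gradient f x))
      ((fun t : ℝ => x + t • (z - x)) 0) := by simpa using h2
  have h4 := h3.comp_hasDerivAt (0 : ℝ) h1
  rwa [InnerProductSpace.toDual_apply_apply] at h4

theorem le_of_hasDerivAt_of_forall_mul_le {φ : ℝ → ℝ} {φ' c : ℝ} (hφ : HasDerivAt φ φ' 0)
    (h : ∀ t ∈ Ioc (0 : ℝ) 1, c * t ≤ φ t - φ 0) : c ≤ φ' := by
  have h1 := hφ.tendsto_slope_zero_right
  refine ge_of_tendsto h1 ?_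
  filter_upwards [Ioc_mem_nhdsGT (zero_lt_one' ℝ)] with t ht
  rw [zero_add, smul_eq_mul, ← div_eq_inv_mul, le_div_iff₀ ht.1]
  exact h t ht

theorem _root_.ConvexOn.add_inner_gradient_le [CompleteSpace E] {X : Set E} {f : E → ℝ}
    (hf : ConvexOn ℝ X f) {x z : E} (hx : x ∈ X) (hz : z ∈ X) (hd : DifferentiableAt ℝ f x) :
    f x + inner ℝ (gradient f x) (z - x) ≤ f z := by
  have h1 := le_of_hasDerivAt_of_forall_mul_le (hasDerivAt_comp_segment hd z).neg
    (c := f x - f z) (fun t ht => by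
      have h2 := hf.2 hx hz (sub_nonneg.2 ht.2) ht.1.le (by ring)
      have h3 : (1 - t) • x + t • z = x + t • (z - x) := by module
      rw [h3, smul_eq_mul, smul_eq_mul] at h2
      simp only [Pi.neg_apply, zero_smul, add_zero]
      linarith)
  linarith

/-- First-order optimality for the sum of a convex function and a differentiable one. -/
theorem add_inner_neg_gradient_le_of_forall_add_le [CompleteSpace E] {X : Set E} {f k : E → ℝ}
    (hk : ConvexOn ℝ X k) {x z : E} (hx : x ∈ X) (hz : z ∈ X) (hd : DifferentiableAt ℝ f x)
    (hmin : ∀ z ∈ X, f x + k x ≤ f z + k z) :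
    k x + inner ℝ (-gradient f x) (z - x) ≤ k z := by
  -- Minimality gives that `f` grows by at least the drop of `k`, and convexity bounds that drop
  -- below by `t * (k x - k z)`.
  have h1 := le_of_hasDerivAt_of_forall_mul_le (hasDerivAt_comp_segment hd z)
    (c := k x - k z) (fun t ht => by
      have h2 := hk.2 hx hz (sub_nonneg.2 ht.2) ht.1.le (by ring)
      have h4 := hk.1 hx hz (sub_nonneg.2 ht.2) ht.1.le (by ring)
      have h3 : (1 - t) • x + t • z = x + t • (z - x) := by module
      rw [h3, smul_eq_mul, smul_eq_mul] at h2
      rw [h3] at h4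
      simp only [zero_smul, add_zero]
      linarith [hmin _ h4])
  rw [inner_neg_left]
  linarith

/-! ### Reduction to real functions on a convex set -/

theorem composite_extendTop {α β : Type*} (Ψ : α → β → ℝ) (X : Set α) (g : α → ℝ)
    (Y : Set β) :
    composite Ψ (extendTop X g) Y = extendTop X (fun x => maxFun Ψ Y x + g x) := by
  funext x
  by_cases hx : x ∈ X
  · rw [composite, extendTop_of_mem hx, extendTop_of_mem hx, EReal.coe_add]
  · rw [composite, extendTop_of_notMem hx, extendTop_of_notMem hx, EReal.coe_add_top]

theorem IsClosedConvexOn.eq_extendTop {Z : Set E} {f : E → EReal} (hf : IsClosedConvexOn Z f) :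
    f = extendTop Z (fun x => (f x).toReal) := by
  funext x
  have hmem : x ∈ Z ↔ f x < ⊤ := by rw [← hf.dom_eq]; rfl
  by_cases hx : x ∈ Z
  · rw [extendTop_of_mem hx, EReal.coe_toReal (hmem.1 hx).ne (hf.ne_bot x)]
  · rw [extendTop_of_notMem hx]
    exact not_lt_top_iff.1 (fun h => hx (hmem.2 h))

theorem IsClosedConvexOn.convexOn {Z : Set E} {g : E → ℝ}
    (hf : IsClosedConvexOn Z (extendTop Z g)) (hZ : Convex ℝ Z) : ConvexOn ℝ Z g := by
  refine convexOn_iff_forall_pos.2 ⟨hZ, fun x hx y hy a b ha hb hab => ?_⟩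
  have h1 := hf.convex x y a b ha hb hab
  rw [extendTop_of_mem hx, extendTop_of_mem hy,
    extendTop_of_mem (hZ hx hy ha.le hb.le hab)] at h1
  exact_mod_cast h1

theorem IsClosedConvexOn.lowerSemicontinuousOn {Z : Set E} {g : E → ℝ}
    (hf : IsClosedConvexOn Z (extendTop Z g)) : LowerSemicontinuousOn g Z := by
  intro x hx c hc
  have h1 := hf.lsc x c (by
    change (c : EReal) < extendTop Z g x
    rw [extendTop_of_mem hx]
    exact_mod_cast hc)
  filter_upwards [nhdsWithin_le_nhds h1, self_mem_nhdsWithin] with z hz hzZ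
  rw [extendTop_of_mem hzZ] at hz
  exact_mod_cast hz

variable {F : Type*} [NormedAddCommGroup F] [InnerProductSpace ℝ F]

/-! ### The max function and the stationarity set -/

namespace StandingAssumptions

variable [CompleteSpace E] {Ψ : E → F → ℝ} {h : E → EReal} {X Ω : Set E} {Y : Set F}

theorem continuousOn_right (hA : StandingAssumptions Ψ h X Ω Y) {x : E} (hx : x ∈ Ω) :
    ContinuousOn (Ψ x) Y :=
  hA.cont.comp (f := fun y => (x, y)) (by fun_prop) fun _ hy => ⟨hx, hy⟩

theorem continuousOn_left (hA : StandingAssumptions Ψ h X Ω Y) {y : F} (hy : y ∈ Y) :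
    ContinuousOn (fun x => Ψ x y) Ω :=
  hA.cont.comp (f := fun x => (x, y)) (by fun_prop) fun _ hx => ⟨hx, hy⟩

theorem concaveOn_right (hA : StandingAssumptions Ψ h X Ω Y) {x : E} (hx : x ∈ Ω) :
    ConcaveOn ℝ Y (Ψ x) :=
  neg_convexOn_iff.1 ((hA.neg_closedConvex x hx).convexOn hA.Y_convex)

theorem le_maxFun (hA : StandingAssumptions Ψ h X Ω Y) {x : E} (hx : x ∈ Ω) {y : F}
    (hy : y ∈ Y) : Ψ x y ≤ maxFun Ψ Y x :=
  le_csSup (hA.Y_compact.image_of_continuousOn (hA.continuousOn_right hx)).bddAbove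
    (mem_image_of_mem _ hy)

theorem nonempty_maximizers (hA : StandingAssumptions Ψ h X Ω Y) {x : E} (hx : x ∈ Ω) :
    (maximizers Ψ Y x).Nonempty := by
  obtain ⟨y, hy, h1, -⟩ :=
    hA.Y_compact.exists_sSup_image_eq_and_ge hA.Y_nonempty (hA.continuousOn_right hx)
  exact ⟨y, hy, h1.symm⟩

theorem convexOn_maxFun (hA : StandingAssumptions Ψ h X Ω Y)
    (hconv : ∀ y ∈ Y, ConvexOn ℝ X (fun x => Ψ x y)) : ConvexOn ℝ X (maxFun Ψ Y) := by
  refine ⟨hA.X_convex, fun x hx z hz a b ha hb hab => ?_⟩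
  obtain ⟨y, hy, hmax⟩ :=
    hA.nonempty_maximizers (hA.X_subset (hA.X_convex hx hz ha hb hab))
  rw [← hmax]
  refine ((hconv y hy).2 hx hz ha hb hab).trans ?_
  simp only [smul_eq_mul]
  gcongr
  · exact hA.le_maxFun (hA.X_subset hx) hy
  · exact hA.le_maxFun (hA.X_subset hz) hy

theorem mem_subdifferential_composite {g : E → ℝ}
    (hA : StandingAssumptions Ψ (extendTop X g) X Ω Y)
    (hconv : ∀ y ∈ Y, ConvexOn ℝ X (fun x => Ψ x y)) {x u : E} (hx : x ∈ X)
    (hu : u ∈ stationaritySet Ψ (extendTop X g) Y x) :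
    u ∈ subdifferential (extendTop X (fun x => maxFun Ψ Y x + g x)) x := by
  obtain ⟨w, hw, v, hv, rfl⟩ := Set.mem_add.1 hu
  obtain ⟨y, ⟨hy, hmax⟩, rfl⟩ := mem_iUnion₂.1 hv
  rw [mem_subdifferential_extendTop_iff hx] at hw ⊢
  intro z hz
  have h1 := (hconv y hy).add_inner_gradient_le hx hz (hA.diff x (hA.X_subset hx) y hy)
  have h2 := hA.le_maxFun (hA.X_subset hz) hy
  rw [inner_add_left, gradX, ← hmax]
  linarith [hw z hz]

/-- If `q + g` decreases at rate at most `M` away from `x`, then the stationarity set at `x`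
contains a vector of norm at most `M`. -/
theorem exists_mem_stationaritySet_norm_le [FiniteDimensional ℝ E] {g : E → ℝ}
    (hA : StandingAssumptions Ψ (extendTop X g) X Ω Y)
    (hconv : ∀ y ∈ Y, ConvexOn ℝ X (fun x => Ψ x y)) {x : E} (hx : x ∈ X) {M : ℝ} (hM : 0 ≤ M)
    (hdec : ∀ z ∈ X, maxFun Ψ Y x + g x - M * ‖z - x‖ ≤ maxFun Ψ Y z + g z) :
    ∃ u ∈ stationaritySet Ψ (extendTop X g) Y x, ‖u‖ ≤ M := by
  have hg : ConvexOn ℝ X g := hA.h_closedConvex.convexOn hA.X_convex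
  have hinner (b : E) : ConvexOn ℝ X (fun z => (inner ℝ b (z - x) : ℝ)) := by
    refine ⟨hA.X_convex, fun z _ z' _ s t _ _ hst => le_of_eq ?_⟩
    have : s • z + t • z' - x = s • (z - x) + t • (z' - x) := by
      rw [smul_sub, smul_sub, sub_add_sub_comm, ← add_smul, hst, one_smul]
    beta_reduce
    rw [this, inner_add_right, inner_smul_right, inner_smul_right, smul_eq_mul, smul_eq_mul]
  -- The ball factor linearizes the norm: `M * ‖z - x‖` is the maximum of `⟨b, z - x⟩` over `‖b‖ ≤
  -- M`.
  obtain ⟨⟨y, b⟩, ⟨hy, hb⟩, hsad⟩ := exists_forall_le_of_forall_exists_le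
    (K := Y ×ˢ Metric.closedBall (0 : E) M) (X := X)
    (g := fun k z => Ψ z k.1 + (g z + inner ℝ k.2 (z - x))) (c := maxFun Ψ Y x + g x)
    (hA.Y_compact.prod (isCompact_closedBall 0 M))
    (hA.Y_convex.prod (convex_closedBall 0 M))
    (hA.Y_nonempty.prod (Metric.nonempty_closedBall.2 hM)) hA.X_convex
    (fun z hz => by
      refine ⟨hA.Y_convex.prod (convex_closedBall 0 M), ?_⟩
      rintro ⟨y, b⟩ ⟨hy, -⟩ ⟨y', b'⟩ ⟨hy', -⟩ s t hs ht hst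
      have h1 := (hA.concaveOn_right (hA.X_subset hz)).2 hy hy' hs ht hst
      have h2 : g z = s * g z + t * g z := by rw [← add_mul, hst, one_mul]
      simp only [Prod.smul_mk, Prod.mk_add_mk, smul_eq_mul, inner_add_left,
        real_inner_smul_left] at h1 ⊢
      linarith)
    (fun z hz => ContinuousOn.upperSemicontinuousOn (by
      have h1 : ContinuousOn (fun k : F × E => Ψ z k.1) (Y ×ˢ Metric.closedBall (0 : E) M) :=
        (hA.continuousOn_right (hA.X_subset hz)).comp continuousOn_fst fun k hk => hk.1
      exact h1.add (Continuous.continuousOn (by fun_prop))))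
    (fun k hk => (hconv k.1 hk.1).add (hg.add (hinner k.2)))
    (fun k hk => (((hA.continuousOn_left hk.1).mono hA.X_subset).lowerSemicontinuousOn).add
      (hA.h_closedConvex.lowerSemicontinuousOn.add
        (ContinuousOn.lowerSemicontinuousOn (Continuous.continuousOn (by fun_prop)))))
    (fun z hz => by
      obtain ⟨y, hy, hmax⟩ := hA.nonempty_maximizers (hA.X_subset hz)
      rcases eq_or_ne z x with rfl | hne
      · exact ⟨(y, 0), ⟨hy, Metric.mem_closedBall_self hM⟩, by simp [hmax]⟩
      have hpos : 0 < ‖z - x‖ := norm_pos_iff.2 (sub_ne_zero.2 hne)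
      refine ⟨(y, (M / ‖z - x‖) • (z - x)), ⟨hy, ?_⟩, ?_⟩
      · rw [mem_closedBall_zero_iff, norm_smul, Real.norm_of_nonneg (by positivity),
          div_mul_cancel₀ _ hpos.ne']
      · have h1 := hdec z hz
        rw [real_inner_smul_left, real_inner_self_eq_norm_sq, hmax]
        have h2 : M / ‖z - x‖ * ‖z - x‖ ^ 2 = M * ‖z - x‖ := by field_simp
        nlinarith [mul_nonneg hM hpos.le])
  simp only at hy hsad
  -- At `z = x` the linear term vanishes, which forces `y` to be a maximizer.
  have hmax : Ψ x y = maxFun Ψ Y x := by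
    refine le_antisymm (hA.le_maxFun (hA.X_subset hx) hy) ?_
    have := hsad x hx
    simp only [sub_self, inner_zero_right, add_zero] at this
    linarith
  -- It remains that `-∇ₓΨ(x, y) - b` is a subgradient of `h`: `x` minimizes `Ψ(·, y) + g + ⟨b, · -
  -- x⟩` over `X`.
  refine ⟨-b, ⟨-gradX Ψ x y - b, ?_, gradX Ψ x y,
    mem_iUnion₂.2 ⟨y, ⟨hy, hmax⟩, mem_singleton _⟩, by module⟩, by simpa using hb⟩
  rw [mem_subdifferential_extendTop_iff hx]
  intro z hz
  have h1 := add_inner_neg_gradient_le_of_forall_add_le (hg.add (hinner b)) hx hz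
    (hA.diff x (hA.X_subset hx) y hy) (fun z hz => by simpa [hmax] using hsad z hz)
  simp only [Pi.add_apply, sub_self, inner_zero_right, add_zero] at h1
  rw [inner_sub_left, gradX]
  linarith

end StandingAssumptions

end MinMax

theorem propositionC5
    {E : Type*} [NormedAddCommGroup E] [InnerProductSpace ℝ E] [FiniteDimensional ℝ E]
    [CompleteSpace E]
    {F : Type*} [NormedAddCommGroup F] [InnerProductSpace ℝ F] [FiniteDimensional ℝ F]
    (Ψ : E → F → ℝ) (h : E → EReal) (X Ω : Set E) (Y : Set F)
    (hA : MinMax.StandingAssumptions Ψ h X Ω Y)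
    (hconv : ∀ y ∈ Y, ConvexOn ℝ X (fun x => Ψ x y))
    (xbar : E) (hx : xbar ∈ X) :
    (∀ d : E, MinMax.HasDirDeriv (MinMax.composite Ψ h Y) xbar d
      (MinMax.dirDeriv (MinMax.composite Ψ h Y) xbar d)) ∧
    (⨅ d ∈ Metric.closedBall (0 : E) 1, MinMax.dirDeriv (MinMax.composite Ψ h Y) xbar d)
      = -(⨅ u ∈ MinMax.stationaritySet Ψ h Y xbar, ((‖u‖ : ℝ) : EReal)) ∧
    ((MinMax.subdifferential h xbar).Nonempty →
      ∃ u ∈ MinMax.stationaritySet Ψ h Y xbar,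
        ∀ v ∈ MinMax.stationaritySet Ψ h Y xbar, ‖u‖ ≤ ‖v‖) := by
  obtain ⟨g, rfl⟩ : ∃ g : E → ℝ, h = MinMax.extendTop X g := ⟨_, hA.h_closedConvex.eq_extendTop⟩
  have hG : ConvexOn ℝ X (fun x => MinMax.maxFun Ψ Y x + g x) :=
    (hA.convexOn_maxFun hconv).add (hA.h_closedConvex.convexOn hA.X_convex)
  rw [MinMax.composite_extendTop]
  set Q := MinMax.stationaritySet Ψ (MinMax.extendTop X g) Y xbar with hQ
  set I := ⨅ d ∈ Metric.closedBall (0 : E) 1,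
    MinMax.dirDeriv (MinMax.extendTop X fun x => MinMax.maxFun Ψ Y x + g x) xbar d with hI
  have hlower : ∀ u ∈ Q, ((-‖u‖ : ℝ) : EReal) ≤ I := fun u hu =>
    le_iInf₂ fun d hd => MinMax.neg_norm_le_dirDeriv_of_mem_subdifferential hG hx
      (hA.mem_subdifferential_composite hconv hx hu) (mem_closedBall_zero_iff.1 hd)
  -- The direction `0` rules out `I = ⊤` and makes `M = -I` nonnegative when `I` is finite.
  have hI0 : I ≤ 0 := by
    refine (iInf₂_le 0 (Metric.mem_closedBall_self zero_le_one)).trans ?_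
    rw [MinMax.dirDeriv_extendTop hG hx]
    refine (iInf₂_le 1 (mem_Ioi.2 one_pos)).trans ?_
    rw [MinMax.slope_extendTop_of_mem hx (by simpa using hx)]
    simp
  have hattain : I ≠ ⊥ → ∃ u ∈ Q, I ≤ ((-‖u‖ : ℝ) : EReal) := by
    intro hbot
    obtain ⟨M, hM⟩ : ∃ M : ℝ, I = ((-M : ℝ) : EReal) :=
      ⟨-I.toReal, by rw [neg_neg, EReal.coe_toReal (hI0.trans_lt EReal.zero_lt_top).ne hbot]⟩
    have hM0 : 0 ≤ M := by
      rw [hM] at hI0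
      have : -M ≤ 0 := by exact_mod_cast hI0
      linarith
    obtain ⟨u, hu, hle⟩ := hA.exists_mem_stationaritySet_norm_le hconv hx hM0
      (fun z hz => MinMax.sub_mul_norm_le_of_le_dirDeriv hG hx
        (fun d hd => hM ▸ iInf₂_le d hd) hz)
    exact ⟨u, hu, by rw [hM, EReal.coe_le_coe_iff]; linarith⟩
  refine ⟨fun d => ?_, le_antisymm ?_ ?_, ?_⟩
  · rw [MinMax.dirDeriv_extendTop hG hx]
    exact MinMax.tendsto_slope_extendTop hG hx d
  · rcases eq_or_ne I ⊥ with hbot | hbot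
    · rw [hbot]
      exact bot_le
    · obtain ⟨u, hu, hle⟩ := hattain hbot
      refine hle.trans ?_
      rw [EReal.coe_neg, EReal.neg_le_neg_iff]
      exact iInf₂_le u hu
  · rw [EReal.neg_le]
    refine le_iInf₂ fun u hu => ?_
    rw [EReal.neg_le, ← EReal.coe_neg]
    exact hlower u hu
  · rintro ⟨w, hw⟩
    obtain ⟨y, hy⟩ := hA.nonempty_maximizers (hA.X_subset hx)
    have hmem : w + MinMax.gradX Ψ xbar y ∈ Q :=
      Set.add_mem_add hw (mem_iUnion₂.2 ⟨y, hy, mem_singleton _⟩)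
    obtain ⟨u, hu, hle⟩ := hattain
      ((EReal.bot_lt_coe _).trans_le (hlower _ hmem)).ne'
    -- The vector `u` has least norm because `-‖v‖ ≤ I ≤ -‖u‖`.
    refine ⟨u, hu, fun v hv => ?_⟩
    have h1 := (hlower v hv).trans hle
    rw [EReal.coe_le_coe_iff] at h1
    linarith
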